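/- Theorem 1.13. Let $p$ be a prime and let $k\ge 1$ and $n\ge 2$ be integers. For $m\ge 1$ put $d_m:=\gcd(k,p^m-1)$, and let $d:=d_1$. Let $M_n(\mathbb F_p)$ be the ring of $n\times n$ matrices over the field $\mathbb F_p$ with $p$ elements, let $GL_n(\mathbb F_p)$ be its group of invertible elements, and let $$P:=\{A^k+B^k\mid A,B\in M_n(\mathbb F_p)\},\qquad Q:=\{A^k+B^k\mid A,B\in GL_n(\mathbb F_p)\}.$$ Suppose that $p>d+1$ and $p\nmid k$. Then the following hold, where $\ln 0:=-\infty$ (this is needed only for $k=1$). (a) If $n>\max\left\{\frac{p-1}{2},\frac{4\ln(k-1)}{\ln p}\right\}$, then $P=M_n(\mathbb F_p)$. (b) If $n>\max\left\{\frac{p-1}{2},\frac{\ln\left((k-1)^4+4k\right)}{\ln p}\right\}$ and $p\,\frac{p^n-1}{d_n}$ is even, then $Q=M_n(\mathbb F_p)$. -/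

import Mathlib

/-- The set `P` of all sums `A ^ k + B ^ k` with `A`, `B` arbitrary `n × n` matrices over `R`. -/
def sumTwoPowers (k n : ℕ) (R : Type*) [CommRing R] : Set (Matrix (Fin n) (Fin n) R) :=
  {M | ∃ A B : Matrix (Fin n) (Fin n) R, M = A ^ k + B ^ k}

/-- The set `Q` of all sums `A ^ k + B ^ k` with `A`, `B` invertible `n × n` matrices over `R`. -/
def sumTwoInvertiblePowers (k n : ℕ) (R : Type*) [CommRing R] :
    Set (Matrix (Fin n) (Fin n) R) :=
  {M | ∃ A B : Matrix (Fin n) (Fin n) R, IsUnit A ∧ IsUnit B ∧ M = A ^ k + B ^ k}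

/-- The number `d_m = gcd (k, q ^ m - 1)`; the subtraction is a true one for `q ≥ 1`. -/
def powGcd (k q m : ℕ) : ℕ := Nat.gcd k (q ^ m - 1)

/-! Nonscalar and scalar matrices need different arguments. A nonscalar matrix can be conjugated to
have any diagonal with the right sum (`Matrix.exists_isConj_diag_eq`). Take each diagonal entry to
be a sum of two terms from `{1, r ^ k}` with `r ^ k ≠ 1`; as `2n ≥ p - 1`, such terms reach every
trace. Cut the matrix into upper plus lower triangular, one term on each diagonal. Since `p ∤ k`,
both pieces are `k`-th powers of invertible matrices, by Newton lifting. A scalar `c` lies in the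
copy of the field with `q = p ^ n` elements inside the matrices, so it suffices to solve `x ^ k + y
^ k = c` there. Characters and `|J(χ, φ)| = √q` settle `c ≠ 0`; the logarithmic hypotheses are the
resulting lower bounds on `q`. For invertible summands of `c = 0`, parity makes `-1` a `k`-th power.
-/

/-! ### Conjugation to a prescribed diagonal -/

lemma Matrix.isConj_mul_mul {K ι : Type*} [Fintype ι] [DecidableEq ι] [CommRing K]
    (A : Matrix ι ι K) {P Q : Matrix ι ι K} (h : P * Q = 1) : IsConj A (P * A * Q) :=
  ⟨⟨P, Q, h, mul_eq_one_comm.mp h⟩, by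
    simp only [SemiconjBy, mul_assoc, mul_eq_one_comm.mp h, mul_one]⟩

/-- A square matrix that is not scalar is conjugate to one with a nonzero off-diagonal entry in
its first row or in its first column. -/
lemma Matrix.exists_isConj_offDiag {K : Type*} [Field K] {m : ℕ}
    (A : Matrix (Fin (m + 1)) (Fin (m + 1)) K)
    (hA : ∃ i j, i ≠ j ∧ (A i j ≠ 0 ∨ A i i ≠ A j j)) :
    ∃ B, IsConj A B ∧ ∃ i, i ≠ 0 ∧ (B i 0 ≠ 0 ∨ B 0 i ≠ 0) := by
  by_cases h0 : ∃ i, i ≠ 0 ∧ (A i 0 ≠ 0 ∨ A 0 i ≠ 0)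
  · exact ⟨A, IsConj.refl A, h0⟩
  push Not at h0
  have conj : ∀ (j : Fin (m + 1)) (hj : j ≠ 0), IsConj A
      (Matrix.transvection j 0 (-1 : K) * A * Matrix.transvection j 0 1) := fun j hj ↦
    A.isConj_mul_mul (by rw [Matrix.transvection_mul_transvection_same j 0 hj]; simp)
  by_cases h1 : ∃ i j, i ≠ j ∧ A i j ≠ 0
  · obtain ⟨i, j, hij, hAij⟩ := h1
    have hi : i ≠ 0 := by rintro rfl; exact hAij (h0 j hij.symm).2
    have hj : j ≠ 0 := by rintro rfl; exact hAij (h0 i hij).1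
    refine ⟨_, conj j hj, i, hi, Or.inl ?_⟩
    rw [Matrix.mul_transvection_apply_same, Matrix.transvection_mul_apply_of_ne _ _ _ _ hij,
      Matrix.transvection_mul_apply_of_ne _ _ _ _ hij, (h0 i hi).1]
    simpa using hAij
  · push Not at h1
    obtain ⟨j, hj, hd⟩ : ∃ j, j ≠ 0 ∧ A j j ≠ A 0 0 := by
      obtain ⟨i, j, hij, h | h⟩ := hA
      · exact absurd (h1 i j hij) h
      · by_contra! hc
        have key : ∀ l, A l l = A 0 0 := fun l ↦ by
          by_cases hl : l = 0
          · rw [hl]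
          · exact hc l hl
        exact h ((key i).trans (key j).symm)
    -- As `A` is diagonal, entry `(j, 0)` of the conjugate is `A j j - A 0 0`.
    refine ⟨_, conj j hj, j, hj, Or.inl ?_⟩
    rw [Matrix.mul_transvection_apply_same, Matrix.transvection_mul_apply_same,
      Matrix.transvection_mul_apply_same, (h0 j hj).1, (h0 j hj).2]
    simpa [← sub_eq_neg_add, sub_eq_zero] using hd

lemma IsConj.matrix_transpose {K ι : Type*} [Fintype ι] [DecidableEq ι] [CommRing K]
    {A B : Matrix ι ι K} (h : IsConj A B) : IsConj A.transpose B.transpose := by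
  obtain ⟨c, hc⟩ := h.symm
  refine ⟨⟨(c : Matrix ι ι K).transpose, (↑c⁻¹ : Matrix ι ι K).transpose, ?_, ?_⟩, ?_⟩
  · rw [← Matrix.transpose_mul, Units.inv_mul, Matrix.transpose_one]
  · rw [← Matrix.transpose_mul, Units.mul_inv, Matrix.transpose_one]
  · simp only [SemiconjBy] at hc ⊢
    rw [← Matrix.transpose_mul, ← Matrix.transpose_mul, hc]

lemma IsConj.matrix_trace_eq {K ι : Type*} [Fintype ι] [DecidableEq ι] [CommRing K]
    {A B : Matrix ι ι K} (h : IsConj A B) : A.trace = B.trace := by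
  obtain ⟨c, hc⟩ := h
  rw [← Matrix.trace_units_conj c A, hc.eq, mul_assoc, Units.mul_inv, mul_one]

/-- Conjugation by a transvection that adds a multiple of row `j` to row `0`. -/
lemma Matrix.exists_isConj_addRow {K : Type*} [Field K] {m : ℕ}
    (A : Matrix (Fin (m + 1)) (Fin (m + 1)) K) {j : Fin (m + 1)} (hj : j ≠ 0) (c : K) :
    ∃ B, IsConj A B ∧ B 0 0 = A 0 0 + c * A j 0 ∧
      (∀ i l, i ≠ 0 → l ≠ j → B i l = A i l) ∧ ∀ i, i ≠ 0 → B i j = A i j - c * A i 0 := by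
  refine ⟨Matrix.transvection 0 j c * A * Matrix.transvection 0 j (-c),
    A.isConj_mul_mul
      (by rw [Matrix.transvection_mul_transvection_same 0 j hj.symm]; simp), ?_, ?_, ?_⟩
  · rw [Matrix.mul_transvection_apply_of_ne _ _ _ _ hj.symm, Matrix.transvection_mul_apply_same]
  · intro i l hi hl
    rw [Matrix.mul_transvection_apply_of_ne _ _ _ _ hl, Matrix.transvection_mul_apply_of_ne _ _ _ _ hi]
  · intro i hi
    rw [Matrix.mul_transvection_apply_same, Matrix.transvection_mul_apply_of_ne _ _ _ _ hi,
      Matrix.transvection_mul_apply_of_ne _ _ _ _ hi]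
    ring

/-- Conjugating the lower right block of a matrix does not change its corner entry. -/
lemma Matrix.exists_isConj_of_submatrix {K : Type*} [CommRing K] {m : ℕ}
    (A : Matrix (Fin (m + 1)) (Fin (m + 1)) K) {B : Matrix (Fin m) (Fin m) K}
    (h : IsConj (A.submatrix Fin.succ Fin.succ) B) :
    ∃ A', IsConj A A' ∧ A' 0 0 = A 0 0 ∧ ∀ i, A' (Fin.succ i) (Fin.succ i) = B i i := by
  let E (P : Matrix (Fin m) (Fin m) K) : Matrix (Fin (m + 1)) (Fin (m + 1)) K :=
    Matrix.of (Fin.cons (Fin.cons 1 0) fun i ↦ Fin.cons 0 (P i))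
  have E00 : ∀ P, E P 0 0 = 1 := fun P ↦ rfl
  have E0s : ∀ P j, E P 0 (Fin.succ j) = 0 := fun P j ↦ rfl
  have Es0 : ∀ P i, E P (Fin.succ i) 0 = 0 := fun P i ↦ rfl
  have Ess : ∀ P i j, E P (Fin.succ i) (Fin.succ j) = P i j := fun P i j ↦ rfl
  have hE : ∀ P Q, P * Q = 1 → E P * E Q = 1 := by
    intro P Q h
    ext i j
    refine Fin.cases ?_ (fun i ↦ ?_) i <;> refine Fin.cases ?_ (fun j ↦ ?_) j <;>
      simp only [Matrix.mul_apply, Fin.sum_univ_succ, E00, E0s, Es0, Ess]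
    · simp
    · simp [(Fin.succ_ne_zero j).symm]
    · simp
    · simp [← Matrix.mul_apply, h, Matrix.one_apply]
  obtain ⟨c, hc⟩ := h
  have hB : B = c * A.submatrix Fin.succ Fin.succ * (↑c⁻¹ : Matrix (Fin m) (Fin m) K) := by
    rw [hc.eq, mul_assoc, Units.mul_inv, mul_one]
  refine ⟨E c * A * E (↑c⁻¹ : Matrix (Fin m) (Fin m) K),
    A.isConj_mul_mul (hE _ _ c.mul_inv), ?_, ?_⟩
  · simp only [Matrix.mul_apply, Fin.sum_univ_succ, E00, E0s, Es0]
    simp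
  · intro i
    simp only [hB, Matrix.mul_apply, Fin.sum_univ_succ, E0s, Es0, Ess, Matrix.submatrix_apply]
    simp

/-- **Fillmore's theorem**: a nonscalar matrix over a field is conjugate to a matrix with any
prescribed diagonal of the right sum. -/
theorem Matrix.exists_isConj_diag_eq {K : Type*} [Field K] (m : ℕ) :
    ∀ (A : Matrix (Fin (m + 2)) (Fin (m + 2)) K)
      (_ : ∃ i j, i ≠ j ∧ (A i j ≠ 0 ∨ A i i ≠ A j j))
      (γ : Fin (m + 2) → K) (_ : ∑ i, γ i = A.trace),
      ∃ B, IsConj A B ∧ ∀ i, B i i = γ i := by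
  induction m with
  | zero =>
    intro A hA γ hγ
    have key : ∀ (A : Matrix (Fin 2) (Fin 2) K), ∑ i, γ i = A.trace → (∃ i, i ≠ 0 ∧ A i 0 ≠ 0) →
        ∃ B, IsConj A B ∧ ∀ i, B i i = γ i := by
      rintro A hγ ⟨i, hi, hAi⟩
      obtain ⟨B, hB, hB0, -⟩ := A.exists_isConj_addRow hi ((γ 0 - A 0 0) / A i 0)
      rw [div_mul_cancel₀ _ hAi, add_sub_cancel] at hB0
      refine ⟨B, hB, ?_⟩
      rw [hB.matrix_trace_eq, Matrix.trace, Fin.sum_univ_two, Fin.sum_univ_two] at hγ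
      simp only [Matrix.diag_apply, hB0, add_right_inj] at hγ
      simp [Fin.forall_fin_two, hB0, hγ]
    obtain ⟨B, hAB, i, hi, h | h⟩ := A.exists_isConj_offDiag hA
    · obtain ⟨C, hC, hd⟩ := key B (hγ.trans hAB.matrix_trace_eq) ⟨i, hi, h⟩
      exact ⟨C, hAB.trans hC, hd⟩
    · obtain ⟨C, hC, hd⟩ := key B.transpose
        (by rw [hγ, hAB.matrix_trace_eq, Matrix.trace_transpose]) ⟨i, hi, h⟩
      exact ⟨C.transpose, hAB.trans (by simpa using hC.matrix_transpose), hd⟩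
  | succ m ih =>
    intro A hA γ hγ
    have key : ∀ (A : Matrix (Fin (m + 3)) (Fin (m + 3)) K), ∑ i, γ i = A.trace →
        (∃ i, i ≠ 0 ∧ A i 0 ≠ 0) → ∃ B, IsConj A B ∧ ∀ i, B i i = γ i := by
      rintro A hγ ⟨i, hi, hAi⟩
      obtain ⟨j, hj, hji⟩ : ∃ j : Fin (m + 3), j ≠ 0 ∧ j ≠ i := by
        have : ∃ j : Fin (m + 3), j ∉ ({0, i} : Finset (Fin (m + 3))) := by
          by_contra! h
          have := (Finset.card_le_card (fun x _ ↦ h x : Finset.univ ⊆ _)).trans Finset.card_le_two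
          simp at this
        simpa using this
      -- Entry `(i, 0)` serves to correct the corner. Entry `(i, j)` survives that correction and
      -- keeps the remaining block nonscalar for the induction.
      obtain ⟨B, hB, hBi, hBij⟩ : ∃ B, IsConj A B ∧ B i 0 ≠ 0 ∧ B i j ≠ 0 := by
        by_cases h : A i j = 0
        · obtain ⟨B, hB, -, h1, h2⟩ := A.exists_isConj_addRow hj 1
          refine ⟨B, hB, by rwa [h1 i 0 hi hj.symm], ?_⟩
          rw [h2 i hi, h]
          simpa using hAi
        · exact ⟨A, IsConj.refl A, hAi, h⟩
      obtain ⟨C, hC, hC0, h1, -⟩ := B.exists_isConj_addRow hi ((γ 0 - B 0 0) / B i 0)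
      rw [div_mul_cancel₀ _ hBi, add_sub_cancel] at hC0
      have htr : ∑ l, γ l = C.trace := hγ.trans (hB.trans hC).matrix_trace_eq
      rw [Matrix.trace, Fin.sum_univ_succ, Fin.sum_univ_succ (fun l ↦ C.diag l)] at htr
      simp only [Matrix.diag_apply, hC0, add_right_inj] at htr
      obtain ⟨D, hD, hDγ⟩ := ih (C.submatrix Fin.succ Fin.succ)
        ⟨i.pred hi, j.pred hj, by simpa using hji.symm, Or.inl (by
          simpa [h1 i j hi hji] using hBij)⟩ (fun l ↦ γ l.succ) htr
      obtain ⟨A', hA', h0, hs⟩ := C.exists_isConj_of_submatrix hD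
      refine ⟨A', (hB.trans hC).trans hA', fun l ↦ ?_⟩
      refine Fin.cases (h0.trans hC0) (fun l ↦ (hs l).trans (hDγ l)) l
    obtain ⟨B, hAB, i, hi, h | h⟩ := A.exists_isConj_offDiag hA
    · obtain ⟨C, hC, hd⟩ := key B (hγ.trans hAB.matrix_trace_eq) ⟨i, hi, h⟩
      exact ⟨C, hAB.trans hC, hd⟩
    · obtain ⟨C, hC, hd⟩ := key B.transpose
        (by rw [hγ, hAB.matrix_trace_eq, Matrix.trace_transpose]) ⟨i, hi, h⟩
      exact ⟨C.transpose, hAB.trans (by simpa using hC.matrix_transpose), hd⟩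

/-! ### Roots of matrices by interpolation and Newton lifting -/

open Polynomial in
/-- A matrix whose eigenvalues lie in the base field and are nonzero `k`-th powers there is
itself a `k`-th power, provided `k` is invertible. -/
theorem Matrix.exists_pow_eq_of_charpoly_eq_prod {F ι κ : Type*} [Field F] [Fintype ι]
    [DecidableEq ι] [Fintype κ] {k : ℕ} (hk : (k : F) ≠ 0) (A : Matrix ι ι F) (a : κ → F)
    (hA : A.charpoly = ∏ i, (X - C (a i))) (ha : ∀ i, ∃ r : F, r ≠ 0 ∧ r ^ k = a i) :
    ∃ B : Matrix ι ι F, B ^ k = A := by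
  classical
  -- The root must depend on the eigenvalue, not on its index, so that repeated eigenvalues can be
  -- interpolated.
  have hr : ∃ r : F → F, ∀ i, r (a i) ≠ 0 ∧ r (a i) ^ k = a i := by
    refine ⟨fun x ↦ if h : ∃ r : F, r ≠ 0 ∧ r ^ k = x then h.choose else 0, fun i ↦ ?_⟩
    simp only [dif_pos (ha i)]
    exact (ha i).choose_spec
  obtain ⟨r, hr⟩ := hr
  set s : Finset F := Finset.univ.image a
  set g : F[X] := Lagrange.interpolate s id r
  have hg : ∀ i, g.eval (a i) = r (a i) := fun i ↦
    Lagrange.eval_interpolate_at_node (i := a i) r (Function.injective_id.injOn)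
      (Finset.mem_image_of_mem a (Finset.mem_univ i))
  have hdvd : A.charpoly ∣ (g ^ k - X) ^ Fintype.card κ := by
    rw [hA, ← Finset.card_univ, ← Finset.prod_const]
    refine Finset.prod_dvd_prod_of_dvd _ _ fun i _ ↦ ?_
    rw [dvd_iff_isRoot]
    simp [hg, (hr i).2]
  have hcop : IsCoprime g A.charpoly := by
    rw [hA]
    refine IsCoprime.prod_right fun i _ ↦ ?_
    refine ((irreducible_X_sub_C (a i)).coprime_iff_not_dvd.mpr ?_).symm
    rw [dvd_iff_isRoot, IsRoot, hg]
    exact (hr i).1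
  let S := AdjoinRoot A.charpoly
  let x : S := AdjoinRoot.mk A.charpoly g
  let f : S[X] := X ^ k - C (AdjoinRoot.root A.charpoly)
  -- `g` is a `k`-th root of `X` up to nilpotents modulo the characteristic polynomial; Newton's
  -- method makes it exact, and Cayley-Hamilton carries it to `A`.
  have hnil : IsNilpotent (aeval x f) := by
    refine ⟨Fintype.card κ, ?_⟩
    have : aeval x f = AdjoinRoot.mk A.charpoly (g ^ k - X) := by
      simp [f, x, AdjoinRoot.mk_X]
    rw [this, ← map_pow, AdjoinRoot.mk_eq_zero]
    exact hdvd
  have hx : IsUnit x := by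
    obtain ⟨u, v, huv⟩ := hcop
    refine IsUnit.of_mul_eq_one (AdjoinRoot.mk A.charpoly u) ?_
    have := congrArg (AdjoinRoot.mk A.charpoly) huv
    simpa [x, mul_comm] using this
  have hunit : IsUnit (aeval x (derivative f)) := by
    have : aeval x (derivative f) = algebraMap F S k * x ^ (k - 1) := by
      simp only [f, derivative_sub, derivative_X_pow, derivative_C, sub_zero, map_mul, map_pow,
        aeval_X, aeval_C]
      simp
    rw [this]
    exact ((IsUnit.mk0 _ hk).map _).mul (hx.pow _)
  obtain ⟨y, ⟨-, hy⟩, -⟩ := Polynomial.existsUnique_nilpotent_sub_and_aeval_eq_zero hnil hunit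
  have hy' : y ^ k = AdjoinRoot.root A.charpoly := by
    simpa [f, sub_eq_zero] using hy
  obtain ⟨h, rfl⟩ := AdjoinRoot.mk_surjective y
  rw [← map_pow, ← AdjoinRoot.mk_X, AdjoinRoot.mk_eq_mk] at hy'
  obtain ⟨w, hw⟩ := hy'
  refine ⟨aeval A h, ?_⟩
  have := congrArg (aeval A) hw
  simpa [Matrix.aeval_self_charpoly, sub_eq_zero] using this

/-- An upper triangular matrix whose diagonal entries are nonzero `k`-th powers is the `k`-th
power of an invertible matrix, provided `k` is invertible. -/
theorem Matrix.IsUpperTriangular.exists_isUnit_pow_eq {F ι : Type*} [Field F] [Fintype ι]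
    [LinearOrder ι] {k : ℕ} (hk : (k : F) ≠ 0) {A : Matrix ι ι F}
    (hA : A.IsUpperTriangular) (ha : ∀ i, ∃ r : F, r ≠ 0 ∧ r ^ k = A i i) :
    ∃ B : Matrix ι ι F, IsUnit B ∧ B ^ k = A := by
  obtain ⟨B, hB⟩ := A.exists_pow_eq_of_charpoly_eq_prod hk (fun i ↦ A i i)
    (Matrix.charpoly_of_isUpperTriangular A hA) ha
  have hk0 : k ≠ 0 := by rintro rfl; simp at hk
  refine ⟨B, ?_, hB⟩
  rw [← isUnit_pow_iff hk0, hB, Matrix.isUnit_iff_isUnit_det, Matrix.det_of_isUpperTriangular hA,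
    isUnit_iff_ne_zero, Finset.prod_ne_zero_iff]
  intro i _
  obtain ⟨r, hr, h⟩ := ha i
  rw [← h]
  exact pow_ne_zero _ hr

/-! ### Sums of powers modulo a prime -/

/-- If `gcd (k, p - 1) < p - 1`, then some nonzero residue class modulo `p` has a `k`-th power
different from `1`. -/
lemma ZMod.exists_pow_ne_one {p k : ℕ} [Fact p.Prime] (h : powGcd k p 1 + 1 < p) :
    ∃ r : ZMod p, r ≠ 0 ∧ r ^ k ≠ 1 := by
  by_contra! hc
  have : Fintype.card (ZMod p) - 1 ∣ k := by
    rw [← FiniteField.forall_pow_eq_one_iff]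
    intro x
    ext
    simpa using hc x x.ne_zero
  rw [ZMod.card] at this
  rw [powGcd, pow_one, Nat.gcd_eq_right this] at h
  lia

/-- Every residue class modulo `p` is a sum of at least `p - 1` terms, each of which is `1`
or a fixed `s ≠ 1`. -/
lemma ZMod.exists_sum_ite_eq {p : ℕ} [Fact p.Prime] {ι : Type*} [Fintype ι] [DecidableEq ι]
    (hι : p ≤ Fintype.card ι + 1) {s : ZMod p} (hs : s ≠ 1) (t : ZMod p) :
    ∃ T : Finset ι, ∑ i, (if i ∈ T then s else 1) = t := by
  -- The number of terms equal to `s`; it is at most `p - 1`, hence at most `card ι`.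
  set j := ((t - Fintype.card ι) / (s - 1) : ZMod p).val
  have hj : j ≤ (Finset.univ : Finset ι).card := by
    have := ZMod.val_lt ((t - Fintype.card ι) / (s - 1) : ZMod p)
    rw [Finset.card_univ]
    lia
  obtain ⟨T, -, hT⟩ := Finset.exists_subset_card_eq hj
  refine ⟨T, ?_⟩
  have : ∀ i, (if i ∈ T then s else 1) = 1 + if i ∈ T then s - 1 else 0 := fun i ↦ by
    split_ifs <;> ring
  simp only [this, Finset.sum_add_distrib, Finset.sum_ite_mem, Finset.univ_inter,
    Finset.sum_const, hT, Finset.card_univ, nsmul_eq_mul, mul_one]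
  rw [ZMod.natCast_val, ZMod.cast_id', id, div_mul_cancel₀ _ (sub_ne_zero.mpr hs)]
  ring

/-! ### Counting sums of two powers with characters -/

open scoped Classical in
/-- The number of complex multiplicative characters of a field whose order divides `k` is at
most `k`. -/
lemma MulChar.card_filter_pow_eq_one_le {F : Type*} [Field F] [Fintype F]
    [Fintype (MulChar F ℂ)] {k : ℕ} (hk : 0 < k) :
    (Finset.univ.filter fun χ : MulChar F ℂ ↦ χ ^ k = 1).card ≤ k := by
  obtain ⟨g, hg⟩ := IsCyclic.exists_generator (α := Fˣ)
  refine (Finset.card_le_card_of_injOn (fun χ ↦ χ g)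
    (t := (Polynomial.nthRoots k (1 : ℂ)).toFinset) ?_ ?_).trans
    ((Multiset.toFinset_card_le _).trans (Polynomial.card_nthRoots k 1))
  · intro χ hχ
    have hχ : χ ^ k = 1 := by simpa using hχ
    have := congrArg (fun φ : MulChar F ℂ ↦ φ g) hχ
    simpa [Polynomial.mem_nthRoots hk, MulChar.pow_apply_coe] using this
  · intro χ _ φ _ h
    have h : χ g = φ g := h
    refine MulChar.ext fun x ↦ ?_
    obtain ⟨m, rfl⟩ := (Submonoid.mem_powers_iff _ _).mp (mem_powers_iff_mem_zpowers.mpr (hg x))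
    simp [h]

open scoped Classical in
/-- The sum over all characters of order dividing `k` vanishes off the nonzero `k`-th powers. -/
lemma MulChar.exists_pow_eq_of_sum_ne_zero {F : Type*} [Field F] [Fintype F]
    [Fintype (MulChar F ℂ)] {k : ℕ} {u : F}
    (h : ∑ χ : MulChar F ℂ with χ ^ k = 1, χ u ≠ 0) : ∃ x : F, x ≠ 0 ∧ x ^ k = u := by
  have hu : u ≠ 0 := by
    rintro rfl
    simp at h
  by_contra! hc
  let H : Subgroup Fˣ := (powMonoidHom k : Fˣ →* Fˣ).range
  have hH : (QuotientGroup.mk' H) (Units.mk0 u hu) ≠ 1 := by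
    rw [Ne, ← MonoidHom.mem_ker, QuotientGroup.ker_mk']
    rintro ⟨y, hy⟩
    refine hc y y.ne_zero ?_
    simpa using congrArg Units.val hy
  obtain ⟨φ, hφ⟩ := CommGroup.exists_apply_ne_one_of_hasEnoughRootsOfUnity (Fˣ ⧸ H) ℂ hH
  let χ : MulChar F ℂ := MulChar.ofUnitHom (φ.comp (QuotientGroup.mk' H))
  have hχ : ∀ x : Fˣ, χ x = φ (QuotientGroup.mk' H x) := fun x ↦ by
    simp [χ]
  have hχk : χ ^ k = 1 := by
    refine MulChar.ext fun x ↦ ?_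
    have hx : QuotientGroup.mk' H (x ^ k) = 1 := by
      rw [← MonoidHom.mem_ker, QuotientGroup.ker_mk']
      exact ⟨x, rfl⟩
    rw [MulChar.pow_apply_coe, hχ, MulChar.one_apply_coe, ← Units.val_pow_eq_pow_val, ← map_pow,
      ← map_pow, hx, map_one, Units.val_one]
  have hχu : χ u ≠ 1 := by
    have := hχ (Units.mk0 u hu)
    rw [Units.val_mk0] at this
    rw [this]
    simpa [Units.val_eq_one] using hφ
  -- Multiplication by `χ` permutes the characters summed over, so `χ u ≠ 1` forces the sum to
  -- vanish.
  have hmul : χ u * ∑ ψ : MulChar F ℂ with ψ ^ k = 1, ψ u =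
      ∑ ψ : MulChar F ℂ with ψ ^ k = 1, ψ u := by
    rw [Finset.mul_sum]
    refine Finset.sum_equiv (Equiv.mulLeft χ) (fun ψ ↦ ?_) fun ψ _ ↦ ?_
    · simp [mul_pow, hχk]
    · simp
  exact hχu ((mul_eq_right₀ h).mp hmul)

/-- Inverting both characters conjugates the Jacobi sum, and the product of the two sums is `|F|`.
-/
lemma norm_jacobiSum {F : Type*} [Field F] [Fintype F] {χ φ : MulChar F ℂ} (hχ : χ ≠ 1)
    (hφ : φ ≠ 1) (hχφ : χ * φ ≠ 1) : ‖jacobiSum χ φ‖ = √(Fintype.card F : ℝ) := by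
  classical
  have hchar : ringChar ℂ ≠ ringChar F := by
    rw [ringChar.eq_zero]
    exact (CharP.ringChar_ne_zero_of_finite F).symm
  have h := jacobiSum_mul_jacobiSum_inv hchar hχ hφ hχφ
  have hconj : jacobiSum χ⁻¹ φ⁻¹ = starRingEnd ℂ (jacobiSum χ φ) := by
    rw [← jacobiSum_ringHomComp, ← MulChar.star_eq_inv, ← MulChar.star_eq_inv]
    rfl
  rw [hconj, Complex.mul_conj, Complex.normSq_eq_norm_sq] at h
  have h : ‖jacobiSum χ φ‖ ^ 2 = (Fintype.card F : ℝ) := by exact_mod_cast h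
  rw [← h, Real.sqrt_sq (norm_nonneg _)]

lemma sum_mulChar_mul_mulChar_sub {F R : Type*} [Field F] [Fintype F] [CommRing R]
    (χ φ : MulChar F R) {a : F} (ha : a ≠ 0) :
    ∑ u, χ u * φ (a - u) = χ a * φ a * jacobiSum χ φ := by
  rw [jacobiSum, Finset.mul_sum, ← Equiv.sum_comp (Equiv.mulLeft₀ a ha)]
  refine Finset.sum_congr rfl fun t _ ↦ ?_
  rw [Equiv.mulLeft₀_apply, ← mul_one_sub, map_mul, map_mul]
  ring

lemma MulChar.norm_apply_of_ne_zero {F : Type*} [Field F] [Fintype F] (χ : MulChar F ℂ) {a : F}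
    (ha : a ≠ 0) : ‖χ a‖ = 1 := by
  classical
  lift a to Fˣ using ha.isUnit
  exact Complex.norm_eq_one_of_mem_rootsOfUnity (χ.apply_mem_rootsOfUnity a)

open scoped Classical in
/-- A weighted count of the representations of `a ≠ 0` as a sum of two nonzero `k`-th powers,
with its main terms split off. -/
lemma norm_sum_mulChar_sub_le {F : Type*} [Field F] [Fintype F]
    [Fintype (MulChar F ℂ)] (k : ℕ) {a : F} (ha : a ≠ 0) {X : Finset (MulChar F ℂ)}
    (hX : X = (Finset.univ.filter fun χ : MulChar F ℂ ↦ χ ^ k = 1).erase 1) :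
    ‖(∑ u : F, (∑ χ : MulChar F ℂ with χ ^ k = 1, χ u) *
        ∑ χ : MulChar F ℂ with χ ^ k = 1, χ (a - u)) -
        ((Fintype.card F - 2) - 2 * ∑ χ ∈ X, χ a)‖ ≤
      X.card * (1 + (X.card - 1) * √(Fintype.card F : ℝ)) := by
  set W : Finset (MulChar F ℂ) := Finset.univ.filter fun χ ↦ χ ^ k = 1 with hW
  have h1W : (1 : MulChar F ℂ) ∈ W := by simp [hW]
  set g : MulChar F ℂ → MulChar F ℂ → ℂ := fun χ φ ↦ χ a * φ a * jacobiSum χ φ with hg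
  have hT : (∑ u : F, (∑ χ ∈ W, χ u) * ∑ χ ∈ W, χ (a - u)) = ∑ χ ∈ W, ∑ φ ∈ W, g χ φ := by
    simp_rw [Finset.sum_mul_sum]
    rw [Finset.sum_comm]
    refine Finset.sum_congr rfl fun χ _ ↦ ?_
    rw [Finset.sum_comm]
    exact Finset.sum_congr rfl fun φ _ ↦ sum_mulChar_mul_mulChar_sub χ φ ha
  have h1a : (1 : MulChar F ℂ) a = 1 := MulChar.one_apply ha.isUnit
  have h11 : g 1 1 = Fintype.card F - 2 := by simp [hg, h1a, jacobiSum_one_one]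
  have hne : ∀ {χ}, χ ∈ X → χ ≠ 1 := fun {χ} h ↦ by
    rw [hX] at h
    exact Finset.ne_of_mem_erase h
  have h1n : ∀ χ ∈ X, g 1 χ = - χ a := fun χ hχ ↦ by
    simp [hg, h1a, jacobiSum_one_nontrivial (hne hχ)]
  have hn1 : ∀ χ ∈ X, g χ 1 = - χ a := fun χ hχ ↦ by
    simp [hg, h1a, jacobiSum_comm χ, jacobiSum_one_nontrivial (hne hχ)]
  have hsplit : ∀ f : MulChar F ℂ → ℂ, ∑ χ ∈ W, f χ = f 1 + ∑ χ ∈ X, f χ := fun f ↦ by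
    rw [hX, Finset.add_sum_erase _ _ h1W]
  have hnorm : ∀ χ φ, ‖g χ φ‖ = ‖jacobiSum χ φ‖ := fun χ φ ↦ by
    simp [hg, MulChar.norm_apply_of_ne_zero _ ha]
  have hrow : ∀ χ ∈ X, ‖∑ φ ∈ X, g χ φ‖ ≤ 1 + (X.card - 1) * √(Fintype.card F : ℝ) := by
    intro χ hχ
    -- The one exceptional term of the row: its Jacobi sum has norm `1` instead of `√q`.
    have hinv : χ⁻¹ ∈ X := by
      rw [hX, Finset.mem_erase, Finset.mem_filter] at hχ ⊢
      simpa using hχ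
    rw [← Finset.add_sum_erase _ _ hinv]
    refine (norm_add_le _ _).trans (add_le_add ?_ ?_)
    · rw [hnorm, jacobiSum_nontrivial_inv (hne hχ), norm_neg,
        MulChar.norm_apply_of_ne_zero _ (neg_ne_zero.mpr one_ne_zero)]
    · refine (norm_sum_le_of_le (n := fun _ ↦ √(Fintype.card F : ℝ)) _ fun φ hφ ↦ ?_).trans ?_
      · obtain ⟨hφ1, hφ2⟩ := Finset.mem_erase.mp hφ
        rw [hnorm, norm_jacobiSum (hne hχ) (hne hφ2)]
        exact fun h ↦ hφ1 (mul_eq_one_iff_inv_eq.mp h).symm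
      · rw [Finset.sum_const, Finset.card_erase_of_mem hinv, nsmul_eq_mul,
          Nat.cast_pred (Finset.card_pos.mpr ⟨χ, hχ⟩)]
  have : ∑ χ ∈ W, ∑ φ ∈ W, g χ φ - ((Fintype.card F - 2) - 2 * ∑ χ ∈ X, χ a) =
      ∑ χ ∈ X, ∑ φ ∈ X, g χ φ := by
    simp_rw [hsplit, Finset.sum_add_distrib]
    rw [h11, Finset.sum_congr rfl h1n, Finset.sum_congr rfl hn1, Finset.sum_neg_distrib]
    ring
  rw [hT, this]
  refine (norm_sum_le_of_le _ hrow).trans ?_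
  rw [Finset.sum_const, nsmul_eq_mul]

/-- In a field with more than `(k - 1) ^ 4 + 4 * k` elements, every nonzero element is the sum of
two nonzero `k`-th powers. -/
theorem FiniteField.exists_pow_add_pow_eq_of_ne_zero {F : Type*} [Field F] [Fintype F] {k : ℕ}
    (hk : 1 ≤ k) (hF : ((k : ℝ) - 1) ^ 4 + 4 * k < Fintype.card F) {a : F} (ha : a ≠ 0) :
    ∃ x y : F, x ≠ 0 ∧ y ≠ 0 ∧ x ^ k + y ^ k = a := by
  classical
  let _ : Fintype (MulChar F ℂ) := Fintype.ofFinite _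
  have hle := MulChar.card_filter_pow_eq_one_le (F := F) hk
  obtain ⟨X, hX⟩ : ∃ X, X = (Finset.univ.filter fun χ : MulChar F ℂ ↦ χ ^ k = 1).erase 1 :=
    ⟨_, rfl⟩
  have hcard : X.card + 1 ≤ k := by
    rw [hX, Finset.card_erase_add_one (by simp)]
    exact hle
  have hbound := norm_sum_mulChar_sub_le k ha hX
  set T := ∑ u : F, (∑ χ : MulChar F ℂ with χ ^ k = 1, χ u) *
        ∑ χ : MulChar F ℂ with χ ^ k = 1, χ (a - u) with hT
  have hT0 : T ≠ 0 := by
    intro h0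
    rw [h0, zero_sub, norm_neg] at hbound
    set m : ℝ := (X.card : ℝ)
    set q : ℝ := (Fintype.card F : ℝ)
    have hm0 : 0 ≤ m := Nat.cast_nonneg _
    have hmk : m + 1 ≤ k := show (X.card : ℝ) + 1 ≤ k by exact_mod_cast hcard
    have hS : ‖∑ χ ∈ X, χ a‖ ≤ m := by
      refine (norm_sum_le_of_le (n := fun _ ↦ (1 : ℝ)) _ fun χ _ ↦
        (MulChar.norm_apply_of_ne_zero χ ha).le).trans ?_
      simp [m]
    have hlow : q - 2 - 2 * m ≤ ‖((Fintype.card F : ℂ) - 2) - 2 * ∑ χ ∈ X, χ a‖ := by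
      have h1 := norm_sub_norm_le ((Fintype.card F : ℂ) - 2) (2 * ∑ χ ∈ X, χ a)
      have h2 := norm_sub_norm_le (Fintype.card F : ℂ) 2
      rw [norm_mul] at h1
      simp only [Complex.norm_natCast, Complex.norm_ofNat] at h1 h2
      linarith
    have hq : m ^ 4 + 4 * (m + 1) < q := by
      have : m ^ 4 ≤ ((k : ℝ) - 1) ^ 4 := pow_le_pow_left₀ hm0 (by linarith) 4
      linarith
    have hs2 : √q * √q = q := Real.mul_self_sqrt (Nat.cast_nonneg _)
    have hs0 : 0 ≤ √q := Real.sqrt_nonneg q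
    have hs1 : 1 ≤ √q := by
      rw [Real.one_le_sqrt]
      nlinarith [pow_nonneg hm0 4]
    have hsm : m ^ 2 < √q := by
      rw [Real.lt_sqrt (sq_nonneg m)]
      nlinarith
    -- The excess `4 * (m + 1)` of `q` over `m ^ 4` pays for the terms `2 + 2 * m` lost to the
    -- trivial character.
    have h3 : 2 * (m + 1) < √q * (√q - m ^ 2) := by
      have : 4 * (m + 1) < (√q - m ^ 2) * (√q + m ^ 2) := by nlinarith
      nlinarith
    nlinarith [mul_nonneg hm0 (sub_nonneg.mpr hs1)]
  obtain ⟨u, -, hu⟩ := Finset.exists_ne_zero_of_sum_ne_zero hT0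
  obtain ⟨x, hx, hxu⟩ := MulChar.exists_pow_eq_of_sum_ne_zero (left_ne_zero_of_mul hu)
  obtain ⟨y, hy, hyu⟩ := MulChar.exists_pow_eq_of_sum_ne_zero (right_ne_zero_of_mul hu)
  exact ⟨x, y, hx, hy, by rw [hxu, hyu, add_sub_cancel]⟩

/-- In a field with more than `(k - 1) ^ 4` elements, every element is the sum of two `k`-th
powers. -/
theorem FiniteField.exists_pow_add_pow_eq {F : Type*} [Field F] [Fintype F] {k : ℕ}
    (hk : 1 ≤ k) (hF : ((k : ℝ) - 1) ^ 4 < Fintype.card F) (a : F) :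
    ∃ x y : F, x ^ k + y ^ k = a := by
  classical
  by_cases hpow : ∃ x : F, x ^ k = a
  · obtain ⟨x, hx⟩ := hpow
    exact ⟨x, 0, by rw [hx, zero_pow (by lia), add_zero]⟩
  have ha : a ≠ 0 := by
    rintro rfl
    exact hpow ⟨0, zero_pow (by lia)⟩
  let _ : Fintype (MulChar F ℂ) := Fintype.ofFinite _
  have hle := MulChar.card_filter_pow_eq_one_le (F := F) hk
  obtain ⟨X, hX⟩ : ∃ X, X = (Finset.univ.filter fun χ : MulChar F ℂ ↦ χ ^ k = 1).erase 1 :=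
    ⟨_, rfl⟩
  have hcard : X.card + 1 ≤ k := by
    rw [hX, Finset.card_erase_add_one (by simp)]
    exact hle
  -- As `a` is not a `k`-th power, the main term becomes exactly `q`, so no excess over `(k - 1) ^
  -- 4` is needed.
  have hsum : ∑ χ ∈ X, χ a = -1 := by
    have h0 : ∑ χ : MulChar F ℂ with χ ^ k = 1, χ a = 0 := by
      by_contra h
      obtain ⟨x, -, hx⟩ := MulChar.exists_pow_eq_of_sum_ne_zero h
      exact hpow ⟨x, hx⟩
    rw [← Finset.add_sum_erase _ _ (by simp : (1 : MulChar F ℂ) ∈ _), ← hX,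
      MulChar.one_apply ha.isUnit] at h0
    exact (neg_eq_of_add_eq_zero_right h0).symm
  have hbound := norm_sum_mulChar_sub_le k ha hX
  set T := ∑ u : F, (∑ χ : MulChar F ℂ with χ ^ k = 1, χ u) *
        ∑ χ : MulChar F ℂ with χ ^ k = 1, χ (a - u) with hT
  have hT0 : T ≠ 0 := by
    intro h0
    have hmain : (0 : ℂ) - ((Fintype.card F : ℂ) - 2 - 2 * -1) = -(Fintype.card F : ℂ) := by ring
    rw [h0, hsum, hmain, norm_neg, Complex.norm_natCast] at hbound
    set q : ℝ := (Fintype.card F : ℝ)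
    have hq0 : 1 ≤ q := Nat.one_le_cast.mpr Fintype.card_pos
    have hs2 : √q * √q = q := Real.mul_self_sqrt (Nat.cast_nonneg _)
    have hs1 : 1 ≤ √q := by rwa [Real.one_le_sqrt]
    have hm0 : (0 : ℝ) ≤ X.card := Nat.cast_nonneg _
    set m : ℝ := (X.card : ℝ)
    have hq : m ^ 4 < q := by
      have hmk : m + 1 ≤ k := show (X.card : ℝ) + 1 ≤ k by exact_mod_cast hcard
      have : m ^ 4 ≤ ((k : ℝ) - 1) ^ 4 := pow_le_pow_left₀ hm0 (by linarith) 4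
      linarith
    have hsm : m ^ 2 < √q := by
      rw [Real.lt_sqrt (sq_nonneg m)]
      nlinarith
    nlinarith [mul_nonneg hm0 (sub_nonneg.mpr hs1)]
  obtain ⟨u, -, hu⟩ := Finset.exists_ne_zero_of_sum_ne_zero hT0
  obtain ⟨x, -, hxu⟩ := MulChar.exists_pow_eq_of_sum_ne_zero (left_ne_zero_of_mul hu)
  obtain ⟨y, -, hyu⟩ := MulChar.exists_pow_eq_of_sum_ne_zero (right_ne_zero_of_mul hu)
  exact ⟨x, y, by rw [hxu, hyu, add_sub_cancel]⟩

/-- If `(|F| - 1) / gcd (k, |F| - 1)` is even, then `-1` is a `k`-th power in `F`. -/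
lemma FiniteField.exists_pow_eq_neg_one {F : Type*} [Field F] [Fintype F] {k : ℕ}
    (h : Even ((Fintype.card F - 1) / Nat.gcd k (Fintype.card F - 1))) :
    ∃ x : F, x ≠ 0 ∧ x ^ k = -1 := by
  classical
  -- An even group of `k`-th powers contains an element of order `2`, which can only be `-1`.
  have hcard : 2 ∣ Nat.card (powMonoidHom k : Fˣ →* Fˣ).range := by
    rw [IsCyclic.card_powMonoidHom_range, Nat.card_eq_fintype_card, Fintype.card_units,
      Nat.gcd_comm]
    exact h.two_dvd
  have : Fact (Nat.Prime 2) := ⟨Nat.prime_two⟩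
  obtain ⟨⟨y, hyr⟩, hy⟩ := exists_prime_orderOf_dvd_card' 2 hcard
  obtain ⟨x, hx⟩ := MonoidHom.mem_range.mp hyr
  rw [Subgroup.orderOf_mk, orderOf_eq_prime_iff] at hy
  refine ⟨x, x.ne_zero, ?_⟩
  have hy2 : (y : F) ^ 2 = 1 := by
    rw [← Units.val_pow_eq_pow_val, hy.1, Units.val_one]
  have hxy : (x : F) ^ k = y := by
    rw [← hx]
    simp
  rw [hxy]
  exact (sq_eq_one_iff.mp hy2).resolve_left fun h1 ↦ hy.2 (Units.ext h1)

/-! ### From the field to matrices -/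

/-- The regular representation of the field with `p ^ n` elements over its prime field. -/
lemma Matrix.exists_algHom_galoisField (p n : ℕ) [Fact p.Prime] (hn : n ≠ 0) :
    Nonempty (GaloisField p n →ₐ[ZMod p] Matrix (Fin n) (Fin n) (ZMod p)) :=
  ⟨Algebra.leftMulMatrix (Module.finBasisOfFinrankEq _ _ (GaloisField.finrank p hn))⟩

/-- A matrix over `ZMod p` that is not scalar is the sum of two `k`-th powers of invertible
matrices as soon as `p ≤ 2 * n + 1`. -/
theorem mem_sumTwoInvertiblePowers_of_not_scalar {p : ℕ} [Fact p.Prime] {k m : ℕ}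
    (hp : powGcd k p 1 + 1 < p) (hpk : ¬ p ∣ k) (hn : p ≤ 2 * (m + 2) + 1)
    (M : Matrix (Fin (m + 2)) (Fin (m + 2)) (ZMod p))
    (hM : ∃ i j, i ≠ j ∧ (M i j ≠ 0 ∨ M i i ≠ M j j)) :
    M ∈ sumTwoInvertiblePowers k (m + 2) (ZMod p) := by
  have hk : (k : ZMod p) ≠ 0 := by rwa [Ne, ZMod.natCast_eq_zero_iff]
  obtain ⟨r, hr0, hr1⟩ := ZMod.exists_pow_ne_one hp
  obtain ⟨T, hT⟩ := ZMod.exists_sum_ite_eq (ι := Fin (m + 2) ⊕ Fin (m + 2))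
    (by rw [Fintype.card_sum, Fintype.card_fin]; lia) hr1 M.trace
  have hpow : ∀ x, ∃ y : ZMod p, y ≠ 0 ∧ y ^ k = if x ∈ T then r ^ k else 1 := fun x ↦ by
    split_ifs
    · exact ⟨r, hr0, rfl⟩
    · exact ⟨1, one_ne_zero, one_pow k⟩
  set γ := fun x ↦ if x ∈ T then r ^ k else (1 : ZMod p)
  obtain ⟨N, hMN, hN⟩ := M.exists_isConj_diag_eq m hM (fun i ↦ γ (.inl i) + γ (.inr i)) (by
    rw [← hT, Fintype.sum_sum_type, Finset.sum_add_distrib])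
  let U : Matrix (Fin (m + 2)) (Fin (m + 2)) (ZMod p) := Matrix.of fun i j ↦
    if i < j then N i j else if i = j then γ (.inl i) else 0
  let L : Matrix (Fin (m + 2)) (Fin (m + 2)) (ZMod p) := Matrix.of fun i j ↦
    if j < i then N i j else if i = j then γ (.inr i) else 0
  have hUL : N = U + L := by
    ext i j
    rcases lt_trichotomy i j with h | rfl | h
    · simp [U, L, h, h.not_gt, h.ne]
    · simp [U, L, hN]
    · simp [U, L, h, h.not_gt, h.ne']
  have hU : U.IsUpperTriangular := fun i j h ↦ by
    have h : j < i := h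
    simp [U, h.not_gt, h.ne']
  have hL : L.transpose.IsUpperTriangular := fun i j h ↦ by
    have h : j < i := h
    simp [L, h.not_gt, h.ne]
  obtain ⟨A, hA, hAU⟩ := hU.exists_isUnit_pow_eq hk fun i ↦ by simpa [U] using hpow (.inl i)
  obtain ⟨B, hB, hBL⟩ := hL.exists_isUnit_pow_eq hk fun i ↦ by simpa [L] using hpow (.inr i)
  have hBL : B.transpose ^ k = L := by
    rw [← Matrix.transpose_pow, hBL, Matrix.transpose_transpose]
  have hB : IsUnit B.transpose := Matrix.isUnit_transpose B |>.mpr hB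
  obtain ⟨c, hc⟩ := hMN.symm
  have hconj : M = c * N * (↑c⁻¹ : Matrix (Fin (m + 2)) (Fin (m + 2)) (ZMod p)) := by
    rw [hc.eq, mul_assoc, Units.mul_inv, mul_one]
  refine ⟨c.val * A * c⁻¹.val, c.val * B.transpose * c⁻¹.val,
    (c.isUnit.mul hA).mul c⁻¹.isUnit, (c.isUnit.mul hB).mul c⁻¹.isUnit, ?_⟩
  rw [Units.conj_pow, Units.conj_pow, hAU, hBL, ← add_mul, ← mul_add, ← hUL, hconj]

/-- A real exponent bound in terms of logarithms, cleared of its logarithms. -/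
lemma Real.lt_pow_of_log_div_log_lt {x b : ℝ} {n : ℕ} (hx : 0 < x) (hb : 1 < b)
    (h : Real.log x / Real.log b < n) : x < b ^ n := by
  rwa [div_lt_iff₀ (Real.log_pos hb), ← Real.log_pow, Real.log_lt_log_iff hx (by positivity)] at h

theorem theorem1p13 (p : ℕ) [Fact p.Prime] (k n : ℕ) (hk : 1 ≤ k) (hn : 2 ≤ n)
    (hp : powGcd k p 1 + 1 < p) (hpk : ¬ p ∣ k) :
    (max (((p : ℝ) - 1) / 2) (4 * Real.log ((k : ℝ) - 1) / Real.log (p : ℝ)) < (n : ℝ) →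
      sumTwoPowers k n (ZMod p) = Set.univ) ∧
    (max (((p : ℝ) - 1) / 2)
        (Real.log (((k : ℝ) - 1) ^ 4 + 4 * (k : ℝ)) / Real.log (p : ℝ)) < (n : ℝ) →
      Even (p * ((p ^ n - 1) / powGcd k p n)) →
      sumTwoInvertiblePowers k n (ZMod p) = Set.univ) := by
  have hn0 : n ≠ 0 := by lia
  have hprime : p.Prime := Fact.out
  have hp1 : (1 : ℝ) < p := by exact_mod_cast hprime.one_lt
  have : Fintype (GaloisField p n) := Fintype.ofFinite _
  have hcard : Fintype.card (GaloisField p n) = p ^ n := by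
    rw [← Nat.card_eq_fintype_card, GaloisField.card p n hn0]
  obtain ⟨f⟩ := Matrix.exists_algHom_galoisField p n hn0
  have hnonscalar : ((p : ℝ) - 1) / 2 < n → ∀ M : Matrix (Fin n) (Fin n) (ZMod p),
      M ∈ sumTwoInvertiblePowers k n (ZMod p) ∨ ∃ c : ZMod p, M = algebraMap _ _ c := by
    intro h M
    obtain ⟨m, rfl⟩ := Nat.exists_eq_add_of_le' hn
    by_cases hM : ∃ i j, i ≠ j ∧ (M i j ≠ 0 ∨ M i i ≠ M j j)
    · refine Or.inl (mem_sumTwoInvertiblePowers_of_not_scalar hp hpk ?_ M hM)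
      have : (p : ℝ) < 2 * ((m + 2 : ℕ) : ℝ) + 1 := by linarith
      exact_mod_cast this.le
    · push Not at hM
      refine Or.inr ⟨M 0 0, ?_⟩
      ext i j
      rw [Matrix.algebraMap_matrix_apply]
      split_ifs with hij
      · subst hij
        by_cases hi : i = 0
        · rw [hi]; rfl
        · exact (hM i 0 hi).2
      · exact (hM i j hij).1
  constructor
  · intro h
    obtain ⟨h1, h2⟩ := max_lt_iff.mp h
    refine Set.eq_univ_of_forall fun M ↦ ?_
    obtain ⟨A, B, -, -, hAB⟩ | ⟨c, rfl⟩ := hnonscalar h1 M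
    · exact ⟨A, B, hAB⟩
    have hF : ((k : ℝ) - 1) ^ 4 < Fintype.card (GaloisField p n) := by
      rw [hcard, Nat.cast_pow]
      -- For `k = 1` the logarithm has the default value `Real.log 0 = 0`; the bound is then just `0
      -- < p ^ n`.
      rcases hk.eq_or_lt with rfl | hk1
      · simp only [Nat.cast_one, sub_self, ne_eq, OfNat.ofNat_ne_zero, not_false_eq_true,
          zero_pow]
        positivity
      · have : (1 : ℝ) < k := by exact_mod_cast hk1
        refine Real.lt_pow_of_log_div_log_lt (pow_pos (sub_pos.mpr this) 4) hp1 ?_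
        rw [Real.log_pow]
        exact_mod_cast h2
    obtain ⟨x, y, hxy⟩ := FiniteField.exists_pow_add_pow_eq hk hF (algebraMap _ _ c)
    exact ⟨f x, f y, by rw [← map_pow, ← map_pow, ← map_add, hxy, AlgHom.commutes]⟩
  · intro h heven
    obtain ⟨h1, h2⟩ := max_lt_iff.mp h
    refine Set.eq_univ_of_forall fun M ↦ ?_
    obtain hM | ⟨c, rfl⟩ := hnonscalar h1 M
    · exact hM
    suffices ∃ x y : GaloisField p n, x ≠ 0 ∧ y ≠ 0 ∧ x ^ k + y ^ k = algebraMap _ _ c by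
      obtain ⟨x, y, hx, hy, hxy⟩ := this
      exact ⟨f x, f y, hx.isUnit.map f, hy.isUnit.map f,
        by rw [← map_pow, ← map_pow, ← map_add, hxy, AlgHom.commutes]⟩
    by_cases hc : c = 0
    · have hodd : ¬ Even p := by
        rw [hprime.even_iff]
        rintro rfl
        have : 0 < powGcd k 2 1 := Nat.gcd_pos_of_pos_left _ hk
        lia
      have heven := (Nat.even_mul.mp heven).resolve_left hodd
      rw [powGcd, ← hcard] at heven
      obtain ⟨x, hx, hxk⟩ := FiniteField.exists_pow_eq_neg_one heven
      exact ⟨1, x, one_ne_zero, hx, by simp [hxk, hc]⟩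
    · refine FiniteField.exists_pow_add_pow_eq_of_ne_zero hk ?_ (by simpa using hc)
      have : (1 : ℝ) ≤ k := by exact_mod_cast hk
      rw [hcard, Nat.cast_pow]
      exact Real.lt_pow_of_log_div_log_lt (by positivity) hp1 h2
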